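/- **Channel.** Let $\nu$ be a $\sigma$-finite measure on an output space $\mathcal Y$ and let $p(y|x_1,x_2)$ be jointly measurable and, for every $(x_1,x_2)\in\mathcal X_1\times\mathcal X_2$, a probability density on $\mathcal Y$ with respect to $\nu$. This includes discrete channels (finite or countable alphabets, $\nu$ the counting measure) and continuous channels ($\mathcal X_1=\mathcal X_2=\mathcal Y=\mathbb R$, $\nu$ the Lebesgue measure). The channel $(\mathcal X_1\times\mathcal X_2,p(y|x_1,x_2),\mathcal Y)$ is a memoryless multiple access channel (MAC): $p(y^n|x_1^n,x_2^n)=\prod_{t=1}^n p(y_t|x_{1t},x_{2t})$. All logarithms are to base $2$. **Codes.** Let $\mathbf C_{\mathrm{in}}=(C^1_{\mathrm{in}},C^2_{\mathrm{in}})$ and $\mathbf C_{\mathrm{out}}=(C^1_{\mathrm{out}},C^2_{\mathrm{out}})$ be the input and output link capacities of a cooperation facilitator (CF). An $(n,M_1,M_2,J)$-code with a $(\mathbf C_{\mathrm{in}},\mathbf C_{\mathrm{out}})$-CF consists of integers $M_1,M_2\ge 1$ and, for $i\in\{1,2\}$ and $1\le j\le J$, of finite non-empty sets $\mathcal U_{ij},\mathcal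 V_{ij}$ with $$\sum_{j=1}^J\log|\mathcal U_{ij}|\le nC^i_{\mathrm{in}},\qquad \sum_{j=1}^J\log|\mathcal V_{ij}|\le nC^i_{\mathrm{out}},$$ of maps $\varphi_{ij}:[M_i]\times\prod_{l<j}\mathcal V_{il}\to\mathcal U_{ij}$, $\ \psi_{ij}:\prod_{l\le j}\mathcal U_{1l}\times\prod_{l\le j}\mathcal U_{2l}\to\mathcal V_{ij}$, $\ f_i:[M_i]\times\prod_{l\le J}\mathcal V_{il}\to\mathcal X_i^n$, and of a measurable decoder $g:\mathcal Y^n\to[M_1]\times[M_2]$, where $[M]=\{1,\dots,M\}$. For a message pair $(m_1,m_2)$, define recursively $u_{ij}=\varphi_{ij}(m_i,v_{i1},\dots,v_{i,j-1})$ (sent by encoder $i$ to the CF in round $j$) and $v_{ij}=\psi_{ij}(u_{11},\dots,u_{1j},u_{21},\dots,u_{2j})$ (sent by the CF to encoder $i$ in round $j$). After the $J$ rounds, encoder $i$ transmits $f_i(m_i,v_{i1},\dots,v_{iJ})$ over the channel. Let $\lambda_n(m_1,m_2)$ be the probability that the output $Y^n$ satisfies $g(Y^n)\ne(m_1,m_2)$.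 The average error of the code is $\frac1{M_1M_2}\sum_{m_1,m_2}\lambda_n(m_1,m_2)$ and its maximal error is $\max_{m_1,m_2}\lambda_n(m_1,m_2)$. **Capacity regions.** A pair $(R_1,R_2)\in\mathbb R_{\ge0}^2$ is achievable with $J$ rounds under average (maximal) error if for all $\epsilon,\delta>0$ and all sufficiently large $n$ there is an $(n,M_1,M_2,J)$-code with $\frac1n\log M_i\ge R_i-\delta$ for $i=1,2$ whose average (maximal) error is at most $\epsilon$. Let $\mathscr C^J_{\mathrm{avg}}(\mathbf C_{\mathrm{in}},\mathbf C_{\mathrm{out}})$ and $\mathscr C^J_{\mathrm{max}}(\mathbf C_{\mathrm{in}},\mathbf C_{\mathrm{out}})$ be the closures of the sets of achievable pairs, and let $\mathscr C_{\mathrm{avg}}(\mathbf C_{\mathrm{in}},\mathbf C_{\mathrm{out}})=\overline{\bigcup_{J\ge1}\mathscr C^J_{\mathrm{avg}}(\mathbf C_{\mathrm{in}},\mathbf C_{\mathrm{out}})}$, and similarly $\mathscr C_{\mathrm{max}}(\mathbf C_{\mathrm{in}},\mathbf C_{\mathrm{out}})$. **Theorem.** For a given MAC, let $\mathbf C^*_{\mathrm{in}}=(C^{*1}_{\mathrm{in}},C^{*2}_{\mathrm{in}})$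 satisfy $$\min\{C^{*1}_{\mathrm{in}},C^{*2}_{\mathrm{in}}\}>\sup I(X_1,X_2;Y),$$ where the supremum is over all joint probability distributions of the inputs $(X_1,X_2)$ on $\mathcal X_1\times\mathcal X_2$. Then for every $\mathbf C_{\mathrm{out}}\in\mathbb R^2_{>0}$, $$\mathscr C_{\mathrm{max}}(\mathbf C^*_{\mathrm{in}},\mathbf C_{\mathrm{out}})=\mathscr C_{\mathrm{avg}}(\mathbf C^*_{\mathrm{in}},\mathbf C_{\mathrm{out}}).$$ -/

import Mathlib

open MeasureTheory Filter
open scoped ENNReal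

/-- A memoryless two-user multiple access channel `(X₁ × X₂, p(y|x₁,x₂), Y)`: for every input pair
`x`, `p x` is a probability density on `Y` with respect to the reference measure `ν`.
For `ν` the counting measure on a countable `Y` (all alphabets carrying the discrete σ-algebra) it
is a discrete channel and `p x` a probability mass function; for `X₁ = X₂ = Y = ℝ` and `ν` the
Lebesgue measure it is a continuous channel. -/
structure MAC (X₁ X₂ Y : Type*) [MeasurableSpace X₁] [MeasurableSpace X₂] [MeasurableSpace Y]
    (ν : Measure Y) where
  p : X₁ × X₂ → Y → ℝ≥0∞
  measurable_p : Measurable (Function.uncurry p)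
  lintegral_p : ∀ x, ∫⁻ y, p x y ∂ν = 1

/-- An `(n, M₁, M₂, J)`-code for a channel with a `(Cin, Cout)`-cooperation facilitator (CF).
User `i ∈ {1, 2}` of the paper has index `i - 1 : Fin 2`. Message sets and link alphabets are
finite, and are labelled by initial segments of `ℕ`. -/
structure Code (X₁ X₂ Y : Type*) [MeasurableSpace Y] (Cin Cout : Fin 2 → ℝ) (n J : ℕ) where
  /-- number of messages of encoder `i` -/
  M : Fin 2 → ℕ
  M_pos : ∀ i, 0 < M i
  /-- size of the alphabet for the round-`j` transmission from encoder `i` to the CF -/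
  U : Fin 2 → Fin J → ℕ
  U_pos : ∀ i j, 0 < U i j
  /-- size of the alphabet for the round-`j` transmission from the CF to encoder `i` -/
  V : Fin 2 → Fin J → ℕ
  V_pos : ∀ i j, 0 < V i j
  /-- total rate constraints on the CF input links, in bits -/
  U_rate : ∀ i, ∑ j, Real.logb 2 (U i j) ≤ n * Cin i
  /-- total rate constraints on the CF output links, in bits -/
  V_rate : ∀ i, ∑ j, Real.logb 2 (V i j) ≤ n * Cout i
  /-- round-`j` transmission of encoder `i`, from its message and what it received in the rounds
  before `j` -/
  φ : ∀ (i : Fin 2) (j : Fin J), Fin (M i) → (∀ l : {l : Fin J // l < j}, Fin (V i l.1)) →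
    Fin (U i j)
  /-- round-`j` transmission of the CF to encoder `i`, from all that both encoders sent up to and
  including round `j` -/
  ψ : ∀ (i : Fin 2) (j : Fin J), (∀ (k : Fin 2) (l : {l : Fin J // l ≤ j}), Fin (U k l.1)) →
    Fin (V i j)
  /-- channel input of encoder 1 -/
  f₁ : Fin (M 0) → (∀ j, Fin (V 0 j)) → Fin n → X₁
  /-- channel input of encoder 2 -/
  f₂ : Fin (M 1) → (∀ j, Fin (V 1 j)) → Fin n → X₂
  /-- decoder -/
  g : (Fin n → Y) → ∀ i, Fin (M i)
  measurable_g : Measurable g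

namespace Code

variable {X₁ X₂ Y : Type*} [MeasurableSpace Y] {Cin Cout : Fin 2 → ℝ} {n J : ℕ}

/-- The symbol `v_{ij}` sent by the CF to encoder `i` in round `j` when the message pair is `m`:
`v_{ij} = ψ_{ij}(u_1^j, u_2^j)` with `u_{kl} = φ_{kl}(m_k, v_k^{l-1})`. -/
def v (c : Code X₁ X₂ Y Cin Cout n J) (m : ∀ i, Fin (c.M i)) (j : Fin J) (i : Fin 2) :
    Fin (c.V i j) :=
  c.ψ i j fun k l => c.φ k l.1 (m k) fun l' => c.v m l'.1 k
termination_by j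
decreasing_by exact lt_of_lt_of_le l'.2 l.2

/-- The pair of symbols that the encoders put on the channel at time `t`. -/
def input (c : Code X₁ X₂ Y Cin Cout n J) (m : ∀ i, Fin (c.M i)) (t : Fin n) : X₁ × X₂ :=
  (c.f₁ (m 0) (fun j => c.v m j 0) t, c.f₂ (m 1) (fun j => c.v m j 1) t)

end Code

namespace MAC

variable {X₁ X₂ Y : Type*} [MeasurableSpace X₁] [MeasurableSpace X₂] [MeasurableSpace Y]
  {ν : Measure Y}

/-- The joint law `p(x₁,x₂) p(y|x₁,x₂)` of inputs and output when the input law is `P`. -/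
noncomputable def jointLaw (W : MAC X₁ X₂ Y ν) (P : Measure (X₁ × X₂)) :
    Measure ((X₁ × X₂) × Y) :=
  (P.prod ν).withDensity fun z => W.p z.1 z.2

/-- The mutual information `I(X₁,X₂;Y)` in bits when the inputs have joint law `P`. -/
noncomputable def mutualInfo (W : MAC X₁ X₂ Y ν) (P : Measure (X₁ × X₂)) : ℝ≥0∞ :=
  InformationTheory.klDiv (W.jointLaw P) (P.prod (W.jointLaw P).snd) / ENNReal.ofReal (Real.log 2)

/-- The supremum of `I(X₁,X₂;Y)` over all joint input laws. -/
noncomputable def maxMutualInfo (W : MAC X₁ X₂ Y ν) : ℝ≥0∞ :=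
  ⨆ (P : Measure (X₁ × X₂)) (_ : IsProbabilityMeasure P), W.mutualInfo P

section

variable {Cin Cout : Fin 2 → ℝ} {n J : ℕ}

/-- The probability `λ_n(m₁,m₂)` that the message pair `m` is decoded incorrectly. -/
noncomputable def errorProb (W : MAC X₁ X₂ Y ν) (c : Code X₁ X₂ Y Cin Cout n J)
    (m : ∀ i, Fin (c.M i)) : ℝ≥0∞ :=
  ∫⁻ y in {y | c.g y ≠ m}, ∏ t, W.p (c.input m t) (y t) ∂(Measure.pi fun _ : Fin n => ν)

/-- Average probability of error. -/
noncomputable def avgError (W : MAC X₁ X₂ Y ν) (c : Code X₁ X₂ Y Cin Cout n J) : ℝ≥0∞ :=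
  (∑ m : ∀ i, Fin (c.M i), W.errorProb c m) / ((c.M 0 : ℝ≥0∞) * (c.M 1 : ℝ≥0∞))

/-- Maximal probability of error. -/
noncomputable def maxError (W : MAC X₁ X₂ Y ν) (c : Code X₁ X₂ Y Cin Cout n J) : ℝ≥0∞ :=
  ⨆ m : ∀ i, Fin (c.M i), W.errorProb c m

end

/-- The rate pair `R` is achievable with a `(Cin, Cout)`-CF and `J` rounds of cooperation, with
respect to the error criterion `Pe`. -/
def Achievable (Cin Cout : Fin 2 → ℝ) (J : ℕ)
    (Pe : ∀ n : ℕ, Code X₁ X₂ Y Cin Cout n J → ℝ≥0∞) (R : Fin 2 → ℝ) : Prop :=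
  (∀ i, 0 ≤ R i) ∧ ∀ ε > (0 : ℝ), ∀ δ > (0 : ℝ), ∀ᶠ n : ℕ in atTop,
    ∃ c : Code X₁ X₂ Y Cin Cout n J,
      (∀ i, R i - δ ≤ 1 / (n : ℝ) * Real.logb 2 (c.M i)) ∧ Pe n c ≤ ENNReal.ofReal ε

/-- The average-error capacity region with `J` rounds of cooperation. -/
def avgRegionRounds (W : MAC X₁ X₂ Y ν) (Cin Cout : Fin 2 → ℝ) (J : ℕ) : Set (Fin 2 → ℝ) :=
  closure {R | Achievable Cin Cout J (fun _ c => W.avgError c) R}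

/-- The maximal-error capacity region with `J` rounds of cooperation. -/
def maxRegionRounds (W : MAC X₁ X₂ Y ν) (Cin Cout : Fin 2 → ℝ) (J : ℕ) : Set (Fin 2 → ℝ) :=
  closure {R | Achievable Cin Cout J (fun _ c => W.maxError c) R}

/-- The average-error capacity region of the channel with a `(Cin, Cout)`-CF. -/
def avgRegion (W : MAC X₁ X₂ Y ν) (Cin Cout : Fin 2 → ℝ) : Set (Fin 2 → ℝ) :=
  closure (⋃ (J : ℕ) (_ : 1 ≤ J), W.avgRegionRounds Cin Cout J)

/-- The maximal-error capacity region of the channel with a `(Cin, Cout)`-CF. -/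
def maxRegion (W : MAC X₁ X₂ Y ν) (Cin Cout : Fin 2 → ℝ) : Set (Fin 2 → ℝ) :=
  closure (⋃ (J : ℕ) (_ : 1 ≤ J), W.maxRegionRounds Cin Cout J)

end MAC

/-! ### Product measures and a change-of-measure inequality. -/

namespace MeasureTheory

/-! Maximal error dominates average error, so only the inclusion of the average-error region needs
work. Take a code of length `n` with small average error. The weak converse (`MAC.log_card_le`)
bounds its sum rate by roughly the maximal mutual information, hence by both input link capacities:
the facilitator can be told both messages in full. It can then simulate every round of the code, so
one round suffices.

View the message pairs as a table whose bad entries are those with large error; by Markov they form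
at most an eighth of it. `exists_rows_and_blocks` keeps half of the rows and groups columns into
blocks of size at most `K`, linear in the blocklength, so that each kept row meets each block in an
entry that is not bad. A row and a block are the new messages. Knowing both, the facilitator picks
such an entry and tells the encoders its position in the block (`Code.relabel`); the decoder forgets
the position.

The label costs `log K` extra bits on each output link. These are paid for by lengthening the block
by a small fraction `η`, which is possible because the output capacities are positive. The loss of
`log (2K)` message bits and the padding are negligible in rate. -/

theorem lintegral_fintype_prod_eq_prod {ι E : Type*} [Fintype ι] [MeasurableSpace E]
    (μ : ι → Measure E) [∀ i, SigmaFinite (μ i)] {f : ι → E → ℝ≥0∞} (hf : ∀ i, Measurable (f i)) :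
    ∫⁻ x, ∏ i, f i (x i) ∂(Measure.pi μ) = ∏ i, ∫⁻ x, f i x ∂(μ i) := by
  have hfin : ∀ (n : ℕ) (μ : Fin n → Measure E) (_ : ∀ i, SigmaFinite (μ i))
      (f : Fin n → E → ℝ≥0∞) (_ : ∀ i, Measurable (f i)),
      ∫⁻ x, ∏ i, f i (x i) ∂(Measure.pi μ) = ∏ i, ∫⁻ x, f i x ∂(μ i) := by
    intro n
    induction n with
    | zero => intro μ _ f hf; simp
    | succ n ih =>
      intro μ _ f hf
      have hm := (measurePreserving_piFinSuccAbove μ 0).symm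
      have hf' : Measurable fun x : Fin n → E => ∏ i, f (Fin.succ i) (x i) :=
        Finset.measurable_prod _ fun i _ => (hf _).comp (measurable_pi_apply i)
      rw [← hm.lintegral_comp (f := fun x => ∏ i, f i (x i))
        (Finset.measurable_prod _ fun i _ => (hf i).comp (measurable_pi_apply i))]
      trans ∫⁻ x : E × (Fin n → E), f 0 x.1 * ∏ i, f (Fin.succ i) (x.2 i)
          ∂((μ 0).prod (Measure.pi fun j => μ (Fin.succAbove 0 j)))
      · refine lintegral_congr fun x => ?_
        rw [Fin.prod_univ_succ]
        rfl
      · rw [lintegral_prod_mul (hf 0).aemeasurable hf'.aemeasurable, Fin.prod_univ_succ]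
        simp only [Fin.zero_succAbove]
        rw [ih _ inferInstance _ fun i => hf _]
  let e := (Fintype.equivFin ι).symm
  rw [← (measurePreserving_piCongrLeft μ e).lintegral_comp (f := fun x => ∏ i, f i (x i))
    (Finset.measurable_prod _ fun i _ => (hf i).comp (measurable_pi_apply i))]
  rw [← e.prod_comp (fun i => ∫⁻ x, f i x ∂(μ i)), ← hfin _ _ inferInstance _ fun i => hf (e i)]
  refine lintegral_congr fun x => ?_
  rw [← e.prod_comp]
  refine Finset.prod_congr rfl fun i _ => ?_
  rw [MeasurableEquiv.coe_piCongrLeft]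
  congr 1
  exact Equiv.piCongrLeft_apply_apply (fun _ => E) e x i

theorem Measure.pi_withDensity {ι E : Type*} [Fintype ι] [MeasurableSpace E]
    (μ : ι → Measure E) [∀ i, SigmaFinite (μ i)] {f : ι → E → ℝ≥0∞} (hf : ∀ i, Measurable (f i))
    [∀ i, SigmaFinite ((μ i).withDensity (f i))] :
    Measure.pi (fun i => (μ i).withDensity (f i)) =
      (Measure.pi μ).withDensity fun x => ∏ i, f i (x i) := by
  refine Measure.pi_eq fun s hs => ?_
  rw [withDensity_apply _ (.univ_pi hs), ← lintegral_indicator (.univ_pi hs)]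
  have : ∀ x : ι → E, (Set.univ.pi s).indicator (fun x => ∏ i, f i (x i)) x =
      ∏ i, (s i).indicator (f i) (x i) := by
    intro x
    by_cases hx : x ∈ Set.univ.pi s
    · rw [Set.indicator_of_mem hx]
      exact Finset.prod_congr rfl fun i _ => (Set.indicator_of_mem (hx i trivial) _).symm
    · rw [Set.indicator_of_notMem hx]
      obtain ⟨i, hi⟩ : ∃ i, x i ∉ s i := by simpa [Set.mem_pi] using hx
      exact (Finset.prod_eq_zero (Finset.mem_univ i) (Set.indicator_of_notMem hi _)).symm
  simp_rw [this]
  rw [lintegral_fintype_prod_eq_prod μ fun i => (hf i).indicator (hs i)]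
  refine Finset.prod_congr rfl fun i _ => ?_
  rw [lintegral_indicator (hs i), withDensity_apply _ (hs i)]

/-- The projection of a product probability measure to some of its coordinates. -/
theorem Measure.pi_map_comp_embedding {ι κ Y : Type*} [Fintype ι] [Fintype κ] [MeasurableSpace Y]
    (μ : κ → Measure Y) [∀ i, IsProbabilityMeasure (μ i)] (e : ι ↪ κ) :
    (Measure.pi μ).map (fun y i => y (e i)) = Measure.pi fun i => μ (e i) := by
  classical
  refine (Measure.pi_eq fun s hs => ?_).symm
  rw [Measure.map_apply (by fun_prop) (.univ_pi hs)]
  have : (fun (y : κ → Y) i => y (e i)) ⁻¹' (Set.univ.pi s) =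
      Set.univ.pi fun k => ⋂ (i : ι) (_ : e i = k), s i := by
    ext y
    simp only [Set.mem_preimage, Set.mem_pi, Set.mem_univ, true_imp_iff, Set.mem_iInter]
    exact ⟨fun h k i hi => hi ▸ h i, fun h i => h _ i rfl⟩
  rw [this, Measure.pi_pi, ← Finset.prod_subset (Finset.subset_univ (Finset.univ.map e)),
    Finset.prod_map]
  · refine Finset.prod_congr rfl fun i _ => ?_
    congr 1
    ext y
    simp
  · intro k _ hk
    have : (⋂ (i : ι) (_ : e i = k), s i) = Set.univ := by
      simp only [Set.iInter_eq_univ]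
      intro i hi
      exact absurd (by simp [← hi]) hk
    rw [this, measure_univ]

/-- A Donsker-Varadhan bound for product measures. -/
theorem integral_le_sum_integral_log_add {ι E : Type*} [Fintype ι] [MeasurableSpace E]
    (Q : ι → Measure E) [∀ i, IsProbabilityMeasure (Q i)] {r : ι → E → ℝ≥0∞} (hr : ∀ i, Measurable (r i))
    [∀ i, IsProbabilityMeasure ((Q i).withDensity (r i))]
    (hint : ∀ i, Integrable (fun y => Real.log (r i y).toReal) ((Q i).withDensity (r i)))
    {h : (ι → E) → ℝ} (hh : Measurable h) {b : ℝ} (hb : ∀ y, |h y| ≤ b) :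
    ∫ y, h y ∂(Measure.pi fun i => (Q i).withDensity (r i)) ≤
      ∑ i, ∫ y, Real.log (r i y).toReal ∂((Q i).withDensity (r i)) - 1
        + ∫ y, Real.exp (h y) ∂(Measure.pi Q) := by
  set μ := Measure.pi fun i => (Q i).withDensity (r i) with hμ
  have hμ' : μ = (Measure.pi Q).withDensity fun x => ∏ i, r i (x i) := Measure.pi_withDensity Q hr
  have hpm : Measurable fun x : ι → E => ∏ i, r i (x i) :=
    Finset.measurable_prod _ fun i _ => (hr i).comp (measurable_pi_apply i)
  have hint' : ∀ i, Integrable (fun y : ι → E => Real.log (r i (y i)).toReal) μ :=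
    fun i => integrable_comp_eval (μ := fun i => (Q i).withDensity (r i))
      (f := fun y => Real.log (r i y).toReal) (hint i)
  have hhi : Integrable h μ := .of_bound hh.aestronglyMeasurable b (.of_forall hb)
  have hpos : ∀ᵐ y ∂μ, ∀ i, 0 < (r i (y i)).toReal := by
    rw [ae_all_iff]
    intro i
    have h1 : ∀ᵐ y ∂((Q i).withDensity (r i)), 0 < (r i y).toReal := by
      have h0 : ∀ᵐ y ∂(Q i), r i y < ∞ := by
        refine ae_lt_top (hr i) ?_
        rw [← setLIntegral_univ, ← withDensity_apply _ .univ, measure_univ]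
        simp
      rw [ae_withDensity_iff (hr i)]
      filter_upwards [h0] with y hy hy'
      exact ENNReal.toReal_pos hy' hy.ne
    exact (measurePreserving_eval (fun i => (Q i).withDensity (r i)) i).quasiMeasurePreserving.ae h1
  set g : (ι → E) → ℝ := fun y => h y - ∑ i, Real.log (r i (y i)).toReal with hg
  have hgm : Measurable g := by
    refine hh.sub (Finset.measurable_sum _ fun i _ => ?_)
    exact ((hr i).comp (measurable_pi_apply i)).ennreal_toReal.log
  have hgi : Integrable g μ := hhi.sub (integrable_finsetSum _ fun i _ => hint' i)
  -- Dividing `exp h` by the density undoes the change of measure from `Q`. Only an inequality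
  -- results, since the part of the product of the `Q i` where the density vanishes is lost.
  have hle : ∫⁻ y, ENNReal.ofReal (Real.exp (g y)) ∂μ ≤
      ∫⁻ y, ENNReal.ofReal (Real.exp (h y)) ∂(Measure.pi Q) := by
    have h1 : ∫⁻ y, ENNReal.ofReal (Real.exp (g y)) ∂μ =
        ∫⁻ y, ENNReal.ofReal (Real.exp (h y)) * (∏ i, r i (y i))⁻¹ ∂μ := by
      refine lintegral_congr_ae ?_
      filter_upwards [hpos] with y hy
      rw [hg, Real.exp_sub, Real.exp_sum, div_eq_mul_inv, ENNReal.ofReal_mul (Real.exp_nonneg _)]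
      congr 1
      simp_rw [Real.exp_log (hy _)]
      rw [ENNReal.ofReal_inv_of_pos (Finset.prod_pos fun i _ => hy i), ENNReal.ofReal_prod_of_nonneg
        fun i _ => (hy i).le]
      congr 1
      exact Finset.prod_congr rfl fun i _ =>
        ENNReal.ofReal_toReal (ENNReal.toReal_pos_iff.1 (hy i)).2.ne
    have hm : Measurable fun y => ENNReal.ofReal (Real.exp (h y)) * (∏ i, r i (y i))⁻¹ :=
      (ENNReal.measurable_ofReal.comp (Real.measurable_exp.comp hh)).mul hpm.inv
    rw [h1, hμ', lintegral_withDensity_eq_lintegral_mul _ hpm hm]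
    refine lintegral_mono fun y => ?_
    simp only [Pi.mul_apply]
    rw [mul_left_comm]
    exact mul_le_of_le_one_right' (ENNReal.mul_inv_le_one _)
  have hei : Integrable (fun y => Real.exp (h y)) (Measure.pi Q) := by
    refine .of_bound (Real.measurable_exp.comp hh).aestronglyMeasurable (Real.exp b)
      (.of_forall fun y => ?_)
    rw [Real.norm_eq_abs, Real.abs_exp]
    exact Real.exp_le_exp.2 ((le_abs_self _).trans (hb y))
  have hfin : ∫⁻ y, ENNReal.ofReal (Real.exp (h y)) ∂(Measure.pi Q) ≠ ∞ :=
    (hei.lintegral_lt_top).ne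
  have hegi : Integrable (fun y => Real.exp (g y)) μ := by
    refine ⟨(Real.measurable_exp.comp hgm).aestronglyMeasurable, ?_⟩
    rw [hasFiniteIntegral_iff_ofReal (.of_forall fun y => Real.exp_nonneg _)]
    exact hle.trans_lt hfin.lt_top
  have hexp : ∫ y, Real.exp (g y) ∂μ ≤ ∫ y, Real.exp (h y) ∂(Measure.pi Q) := by
    rw [integral_eq_lintegral_of_nonneg_ae (.of_forall fun y => Real.exp_nonneg _)
      hegi.aestronglyMeasurable,
      integral_eq_lintegral_of_nonneg_ae (.of_forall fun y => Real.exp_nonneg _)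
      hei.aestronglyMeasurable]
    exact ENNReal.toReal_mono hfin hle
  -- The tangent line `g + 1 ≤ exp g` replaces Jensen's inequality; this is why the bound has `-1 +
  -- ∫ exp h` where Donsker-Varadhan has a logarithm.
  have hg1 : ∫ y, g y ∂μ ≤ ∫ y, (Real.exp (g y) - 1) ∂μ :=
    integral_mono hgi (hegi.sub (integrable_const _))
      fun y => by have := Real.add_one_le_exp (g y); simp only; linarith
  rw [integral_sub hegi (integrable_const _), hg, integral_sub hhi
    (integrable_finsetSum _ fun i _ => hint' i), integral_finsetSum _ fun i _ => hint' i] at hg1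
  have hs : ∀ i, ∫ y, Real.log (r i (y i)).toReal ∂μ =
      ∫ y, Real.log (r i y).toReal ∂((Q i).withDensity (r i)) := fun i =>
    integral_comp_eval (μ := fun i => (Q i).withDensity (r i))
      (f := fun y => Real.log (r i y).toReal) (hint i).aestronglyMeasurable
  simp only [hs, integral_const, probReal_univ, smul_eq_mul, mul_one] at hg1
  linarith

end MeasureTheory

/-! ### Mutual information and the weak converse. -/

namespace MAC

variable {X₁ X₂ Y : Type*} [MeasurableSpace X₁] [MeasurableSpace X₂] [MeasurableSpace Y]
  {ν : Measure Y}

theorem measurable_p_apply (W : MAC X₁ X₂ Y ν) (x : X₁ × X₂) : Measurable (W.p x) :=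
  W.measurable_p.comp measurable_prodMk_left

theorem measurable_p_left (W : MAC X₁ X₂ Y ν) (y : Y) : Measurable fun x => W.p x y :=
  W.measurable_p.comp measurable_prodMk_right

/-- The output law when the inputs are `x`. -/
noncomputable def outLaw (W : MAC X₁ X₂ Y ν) (x : X₁ × X₂) : Measure Y :=
  ν.withDensity (W.p x)

instance (W : MAC X₁ X₂ Y ν) (x : X₁ × X₂) : IsProbabilityMeasure (W.outLaw x) :=
  ⟨by rw [outLaw, withDensity_apply _ .univ, setLIntegral_univ, W.lintegral_p]⟩

theorem pi_outLaw [SigmaFinite ν] (W : MAC X₁ X₂ Y ν) {n : ℕ} (x : Fin n → X₁ × X₂) :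
    Measure.pi (fun t => W.outLaw (x t)) =
      (Measure.pi fun _ => ν).withDensity fun y => ∏ t, W.p (x t) (y t) := by
  have (t : Fin n) : SigmaFinite (ν.withDensity (W.p (x t))) :=
    inferInstanceAs (SigmaFinite (W.outLaw (x t)))
  exact Measure.pi_withDensity (fun _ => ν) fun t => W.measurable_p_apply (x t)

theorem errorProb_eq [SigmaFinite ν] (W : MAC X₁ X₂ Y ν) {Cin Cout : Fin 2 → ℝ} {n J : ℕ}
    (c : Code X₁ X₂ Y Cin Cout n J) (m : ∀ i, Fin (c.M i)) :
    W.errorProb c m = Measure.pi (fun t => W.outLaw (c.input m t)) {y | c.g y ≠ m} := by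
  have hs : MeasurableSet {y | c.g y ≠ m} := (c.measurable_g (measurableSet_singleton m)).compl
  rw [pi_outLaw, withDensity_apply _ hs, errorProb]

/-- The density of the output when the input law is `P`. -/
noncomputable def outDensity (W : MAC X₁ X₂ Y ν) (P : Measure (X₁ × X₂)) (y : Y) : ℝ≥0∞ :=
  ∫⁻ x, W.p x y ∂P

theorem measurable_outDensity (W : MAC X₁ X₂ Y ν) (P : Measure (X₁ × X₂)) [SFinite P] :
    Measurable (W.outDensity P) :=
  W.measurable_p.lintegral_prod_left'

theorem snd_jointLaw [SigmaFinite ν] (W : MAC X₁ X₂ Y ν) (P : Measure (X₁ × X₂)) [SFinite P] :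
    (W.jointLaw P).snd = ν.withDensity (W.outDensity P) := by
  ext s hs
  rw [Measure.snd_apply hs, jointLaw, withDensity_apply _ (measurable_snd hs),
    withDensity_apply _ hs, ← Set.univ_prod, ← Measure.prod_restrict, Measure.restrict_univ]
  exact lintegral_prod_symm' _ W.measurable_p

instance [SigmaFinite ν] (W : MAC X₁ X₂ Y ν) (P : Measure (X₁ × X₂)) [IsProbabilityMeasure P] :
    IsProbabilityMeasure (W.jointLaw P) := by
  refine ⟨?_⟩
  rw [jointLaw, withDensity_apply _ .univ, setLIntegral_univ]
  refine (lintegral_prod _ W.measurable_p.aemeasurable).trans ?_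
  simp [W.lintegral_p]

theorem ae_outDensity_lt_top [SigmaFinite ν] (W : MAC X₁ X₂ Y ν) (P : Measure (X₁ × X₂))
    [IsProbabilityMeasure P] : ∀ᵐ y ∂ν, W.outDensity P y < ∞ := by
  refine ae_lt_top (W.measurable_outDensity P) ?_
  rw [← setLIntegral_univ, ← withDensity_apply _ .univ, ← snd_jointLaw, measure_univ]
  simp

/-- Cancelling the output density is legitimate almost everywhere: it is finite, and where it
vanishes so does `W.p x y` for `P`-almost every `x`. This identifies the log-likelihood ratio inside
the mutual information. -/
theorem jointLaw_eq_withDensity [SigmaFinite ν] (W : MAC X₁ X₂ Y ν) (P : Measure (X₁ × X₂))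
    [IsProbabilityMeasure P] :
    W.jointLaw P = (P.prod (W.jointLaw P).snd).withDensity
      fun z => W.p z.1 z.2 / W.outDensity P z.2 := by
  have hq := W.measurable_outDensity P
  have hp : Measurable fun z : (X₁ × X₂) × Y => W.p z.1 z.2 := W.measurable_p
  have hs : SigmaFinite (ν.withDensity (W.outDensity P)) := by
    rw [← snd_jointLaw]; infer_instance
  have hq' : Measurable fun z : (X₁ × X₂) × Y => W.outDensity P z.2 := hq.comp measurable_snd
  rw [snd_jointLaw, prod_withDensity_right hq, jointLaw]
  refine Eq.trans ?_ (withDensity_mul (P.prod ν) hq' (hp.div hq'))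
  refine withDensity_congr_ae ?_
  have h0 : ∀ᵐ z ∂(P.prod ν), W.outDensity P z.2 = 0 → W.p z.1 z.2 = 0 := by
    have hm : MeasurableSet {z : (X₁ × X₂) × Y | W.outDensity P z.2 = 0 → W.p z.1 z.2 = 0} := by
      have h1 : MeasurableSet {z : (X₁ × X₂) × Y | W.outDensity P z.2 = 0} :=
        (hq.comp measurable_snd) (measurableSet_singleton 0)
      have h2 : MeasurableSet {z : (X₁ × X₂) × Y | W.p z.1 z.2 = 0} :=
        hp (measurableSet_singleton 0)
      exact h1.imp h2
    have hae := Measure.ae_prod_mem_iff_ae_ae_mem (μ := ν) (ν := P) (hm.preimage measurable_swap)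
    have : ∀ᵐ z ∂(ν.prod P), z ∈ Prod.swap ⁻¹'
        {z : (X₁ × X₂) × Y | W.outDensity P z.2 = 0 → W.p z.1 z.2 = 0} := by
      rw [hae]
      refine .of_forall fun y => ?_
      by_cases hy : W.outDensity P y = 0
      · rw [outDensity, lintegral_eq_zero_iff (W.measurable_p_left y)] at hy
        filter_upwards [hy] with x hx _ using hx
      · exact .of_forall fun x hx => absurd hx hy
    rw [← Measure.prod_swap]
    exact (ae_map_iff measurable_swap.aemeasurable hm).2 this
  have ht : ∀ᵐ z ∂(P.prod ν), W.outDensity P z.2 < ∞ :=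
    Measure.quasiMeasurePreserving_snd.ae (W.ae_outDensity_lt_top P)
  filter_upwards [h0, ht] with z h0 ht
  simp only [Pi.mul_apply]
  by_cases hz : W.outDensity P z.2 = 0
  · simp [h0 hz]
  · exact (ENNReal.mul_div_cancel hz ht.ne).symm

/-- A finite supremum makes the divergence finite for each input law, and finite divergence includes
integrability of the log-likelihood ratio. The factor `Real.log 2` converts bits to nats. -/
theorem integrable_log_and_integral_le [SigmaFinite ν] (W : MAC X₁ X₂ Y ν)
    (hC : W.maxMutualInfo ≠ ∞) (P : Measure (X₁ × X₂)) [IsProbabilityMeasure P] :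
    Integrable (fun z => Real.log (W.p z.1 z.2 / W.outDensity P z.2).toReal) (W.jointLaw P) ∧
      ∫ z, Real.log (W.p z.1 z.2 / W.outDensity P z.2).toReal ∂(W.jointLaw P) ≤
        W.maxMutualInfo.toReal * Real.log 2 := by
  have hlog : 0 < Real.log 2 := Real.log_pos one_lt_two
  have hI : W.mutualInfo P ≤ W.maxMutualInfo := le_iSup₂_of_le P inferInstance le_rfl
  have hkl : InformationTheory.klDiv (W.jointLaw P) (P.prod (W.jointLaw P).snd) ≤
      W.maxMutualInfo * ENNReal.ofReal (Real.log 2) := by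
    rwa [mutualInfo, ENNReal.div_le_iff (by simpa using hlog) ENNReal.ofReal_ne_top] at hI
  have htop := ENNReal.mul_ne_top hC (ENNReal.ofReal_ne_top (r := Real.log 2))
  obtain ⟨hac, hint⟩ := InformationTheory.klDiv_ne_top_iff.1 (hkl.trans_lt htop.lt_top).ne
  have hllr : llr (W.jointLaw P) (P.prod (W.jointLaw P).snd) =ᵐ[W.jointLaw P]
      fun z => Real.log (W.p z.1 z.2 / W.outDensity P z.2).toReal := by
    have hr : Measurable fun z : (X₁ × X₂) × Y => W.p z.1 z.2 / W.outDensity P z.2 :=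
      Measurable.div W.measurable_p ((W.measurable_outDensity P).comp measurable_snd)
    have := Measure.rnDeriv_withDensity (P.prod (W.jointLaw P).snd) hr
    rw [← jointLaw_eq_withDensity] at this
    filter_upwards [hac.ae_le this] with z hz
    rw [llr, hz]
  refine ⟨hint.congr hllr, ?_⟩
  rw [← integral_congr_ae hllr, ← InformationTheory.toReal_klDiv_of_measure_eq hac (by simp)]
  refine (ENNReal.toReal_mono htop hkl).trans_eq ?_
  rw [ENNReal.toReal_mul, ENNReal.toReal_ofReal hlog.le]

section Empirical

variable {κ : Type*} [Fintype κ]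

/-- The empirical law of a finite family of inputs. -/
noncomputable def empirical (x : κ → X₁ × X₂) : Measure (X₁ × X₂) :=
  (Fintype.card κ : ℝ≥0∞)⁻¹ • ∑ k, Measure.dirac (x k)

instance [Nonempty κ] (x : κ → X₁ × X₂) : IsProbabilityMeasure (empirical x) := by
  refine ⟨?_⟩
  simp [empirical, ENNReal.inv_mul_cancel]

theorem lintegral_empirical (x : κ → X₁ × X₂) {f : X₁ × X₂ → ℝ≥0∞} (hf : Measurable f) :
    ∫⁻ z, f z ∂(empirical x) = (Fintype.card κ : ℝ≥0∞)⁻¹ * ∑ k, f (x k) := by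
  simp [empirical, lintegral_dirac' _ hf]

theorem jointLaw_empirical [SigmaFinite ν] [Nonempty κ] (W : MAC X₁ X₂ Y ν) (x : κ → X₁ × X₂) :
    W.jointLaw (empirical x) =
      (Fintype.card κ : ℝ≥0∞)⁻¹ • ∑ k, (W.outLaw (x k)).map (Prod.mk (x k)) := by
  ext s hs
  have hm : Measurable (s.indicator fun z : (X₁ × X₂) × Y => W.p z.1 z.2) :=
    Measurable.indicator W.measurable_p hs
  rw [jointLaw, withDensity_apply _ hs, ← lintegral_indicator hs, lintegral_prod _ hm.aemeasurable,
    lintegral_empirical x hm.lintegral_prod_right']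
  simp only [Measure.smul_apply, Measure.finsetSum_apply, smul_eq_mul]
  congr 1
  refine Finset.sum_congr rfl fun k _ => ?_
  rw [Measure.map_apply measurable_prodMk_left hs, outLaw,
    withDensity_apply _ (measurable_prodMk_left hs),
    ← lintegral_indicator (measurable_prodMk_left hs)]
  rfl

/-- `Q` is the output law under the empirical input law of the family. The mutual information for
that input law is the average of the divergences of the individual output laws from `Q`, and the
supremum bounds it. -/
theorem exists_outLaw_eq_withDensity [SigmaFinite ν] [Nonempty κ] (W : MAC X₁ X₂ Y ν)
    (hC : W.maxMutualInfo ≠ ∞) (x : κ → X₁ × X₂) :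
    ∃ (Q : Measure Y) (r : κ → Y → ℝ≥0∞), IsProbabilityMeasure Q ∧ (∀ k, Measurable (r k)) ∧
      (∀ k, W.outLaw (x k) = Q.withDensity (r k)) ∧
      (∀ k, Integrable (fun y => Real.log (r k y).toReal) (W.outLaw (x k))) ∧
      ∑ k, ∫ y, Real.log (r k y).toReal ∂(W.outLaw (x k)) ≤
        Fintype.card κ * (W.maxMutualInfo.toReal * Real.log 2) := by
  set P := empirical x with hP
  have hq := W.measurable_outDensity P
  have hr : Measurable fun z : (X₁ × X₂) × Y => W.p z.1 z.2 / W.outDensity P z.2 :=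
    Measurable.div W.measurable_p (hq.comp measurable_snd)
  obtain ⟨hint, hle⟩ := W.integrable_log_and_integral_le hC P
  have hcard : (Fintype.card κ : ℝ≥0∞)⁻¹ ≠ 0 := by simp
  have hcard' : (Fintype.card κ : ℝ≥0∞)⁻¹ ≠ ∞ := by simp
  have hlm : Measurable fun z : (X₁ × X₂) × Y =>
      Real.log (W.p z.1 z.2 / W.outDensity P z.2).toReal := hr.ennreal_toReal.log
  rw [hP, jointLaw_empirical, ← hP, integrable_smul_measure hcard hcard',
    integrable_finsetSum_measure] at hint
  have hint' : ∀ k, Integrable (fun y => Real.log (W.p (x k) y / W.outDensity P y).toReal)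
      (W.outLaw (x k)) := fun k =>
    (integrable_map_measure hlm.aestronglyMeasurable measurable_prodMk_left.aemeasurable).1
      (hint k (Finset.mem_univ k))
  refine ⟨(W.jointLaw P).snd, fun k y => W.p (x k) y / W.outDensity P y, inferInstance,
    fun k => (W.measurable_p_apply _).div hq, fun k => ?_, hint', ?_⟩
  · rw [snd_jointLaw, outLaw]
    refine Eq.trans ?_ (withDensity_mul ν hq ((W.measurable_p_apply (x k)).div hq))
    refine withDensity_congr_ae ?_
    filter_upwards [W.ae_outDensity_lt_top P] with y hy
    by_cases hz : W.outDensity P y = 0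
    -- Every `x k` carries positive empirical mass, so a zero of the mixture density is a zero of
    -- each component.
    · have hz' := hz
      rw [outDensity, hP, lintegral_empirical x (W.measurable_p_left y),
        mul_eq_zero, or_iff_right hcard, Finset.sum_eq_zero_iff] at hz'
      simpa [hz] using hz' k (Finset.mem_univ k)
    · exact (ENNReal.mul_div_cancel hz hy.ne).symm
  · rw [hP, jointLaw_empirical, ← hP, integral_smul_measure, integral_finsetSum_measure hint] at hle
    have : ∀ k, ∫ z, Real.log (W.p z.1 z.2 / W.outDensity P z.2).toReal
        ∂((W.outLaw (x k)).map (Prod.mk (x k))) =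
        ∫ y, Real.log (W.p (x k) y / W.outDensity P y).toReal ∂(W.outLaw (x k)) := fun k =>
      integral_map measurable_prodMk_left.aemeasurable hlm.aestronglyMeasurable
    simp_rw [this, ENNReal.toReal_inv, ENNReal.toReal_natCast, smul_eq_mul] at hle
    rwa [inv_mul_le_iff₀ (by exact_mod_cast Fintype.card_pos)] at hle

end Empirical

/-- The weak converse of the channel coding theorem for the sum rate. -/
theorem log_card_le [SigmaFinite ν] (W : MAC X₁ X₂ Y ν) (hC : W.maxMutualInfo ≠ ∞)
    {Cin Cout : Fin 2 → ℝ} {n J : ℕ} (c : Code X₁ X₂ Y Cin Cout n J) {ε : ℝ} (hε : 0 ≤ ε)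
    (hc : W.avgError c ≤ ENNReal.ofReal ε) :
    (1 - ε) * Real.log (c.M 0 * c.M 1) ≤ n * (W.maxMutualInfo.toReal * Real.log 2) + 1 := by
  have hne : ∀ i, NeZero (c.M i) := fun i => ⟨(c.M_pos i).ne'⟩
  set D := W.maxMutualInfo.toReal * Real.log 2 with hD
  set κ := ∀ i, Fin (c.M i) with hκ
  have hcard : Fintype.card κ = c.M 0 * c.M 1 := by simp [hκ, Fin.prod_univ_two]
  set N : ℝ := c.M 0 * c.M 1 with hN
  have hcard' : (Fintype.card κ : ℝ) = N := by rw [hcard]; push_cast; rfl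
  have hN1 : 1 ≤ N := by
    rw [← hcard']; exact_mod_cast Fintype.card_pos
  -- At each time `t` the reference law comes from the letters that all message pairs use at time
  -- `t`; it does not depend on the message pair.
  choose Q r hQ hr hQr hint hsum using
    fun t : Fin n => W.exists_outLaw_eq_withDensity hC fun m : κ => c.input m t
  let A : κ → Set (Fin n → Y) := fun m => {y | c.g y = m}
  have hA : ∀ m, MeasurableSet (A m) := fun m => c.measurable_g (measurableSet_singleton m)
  let μ : κ → Measure (Fin n → Y) := fun m => Measure.pi fun t => W.outLaw (c.input m t)
  have hlogN : 0 ≤ Real.log N := Real.log_nonneg hN1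
  -- The test function is `log N` on the decoding set of `m` and `0` elsewhere, so its exponential
  -- is `1 + (N - 1)` times the indicator.
  have key : ∀ m : κ, Real.log N * (μ m).real (A m) ≤
      ∑ t, ∫ y, Real.log (r t m y).toReal ∂(W.outLaw (c.input m t)) - 1 +
        (1 + (N - 1) * (Measure.pi Q).real (A m)) := by
    intro m
    have hp : ∀ t, IsProbabilityMeasure ((Q t).withDensity (r t m)) := fun t =>
      hQr t m ▸ inferInstance
    have h := integral_le_sum_integral_log_add Q (fun t => hr t m)
      (fun t => by rw [← hQr t m]; exact hint t m)
      (h := (A m).indicator fun _ => Real.log N) (measurable_const.indicator (hA m))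
      (b := Real.log N) (fun y => by
        by_cases hy : y ∈ A m <;> simp [hy, abs_of_nonneg hlogN, hlogN])
    simp_rw [← hQr] at h
    rw [integral_indicator_const _ (hA m), smul_eq_mul, mul_comm] at h
    refine h.trans_eq ?_
    congr 1
    have : ∀ y, Real.exp ((A m).indicator (fun _ => Real.log N) y) =
        1 + (A m).indicator (fun _ => N - 1) y := by
      intro y
      by_cases hy : y ∈ A m
      · simp [hy, Real.exp_log (zero_lt_one.trans_le hN1)]
      · simp [hy]
    simp_rw [this]
    rw [integral_add (integrable_const _) ((integrable_const _).indicator (hA m)),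
      integral_indicator_const _ (hA m)]
    simp [mul_comm]
  -- The decoding sets partition the output space: under the common reference law the decoder can
  -- only guess. Summed over `m`, the exponential terms beyond `1` therefore contribute just `N -
  -- 1`.
  have hsumQ : ∑ m, (Measure.pi Q).real (A m) = 1 := by
    have hd : ((Finset.univ : Finset κ) : Set κ).PairwiseDisjoint A := fun m _ m' _ hmm =>
      Set.disjoint_left.2 fun y hy hy' => hmm (Eq.trans (Eq.symm hy) hy')
    rw [← measureReal_biUnion_finset hd fun m _ => hA m]
    have : (⋃ m ∈ (Finset.univ : Finset κ), A m) = Set.univ := by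
      ext y; simp [A]
    rw [this, probReal_univ]
  have hsumμ : N * (1 - ε) ≤ ∑ m, (μ m).real (A m) := by
    have herr : ∀ m, W.errorProb c m = ENNReal.ofReal (1 - (μ m).real (A m)) := by
      intro m
      rw [errorProb_eq, ← probReal_compl_eq_one_sub (hA m), ofReal_measureReal]
      rfl
    have hM : ((c.M 0 : ℝ≥0∞) * c.M 1) = ENNReal.ofReal N := by
      rw [hN, ENNReal.ofReal_mul (by positivity), ENNReal.ofReal_natCast, ENNReal.ofReal_natCast]
    rw [avgError, hM, ENNReal.div_le_iff (by simp; linarith) ENNReal.ofReal_ne_top,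
      ← ENNReal.ofReal_mul hε] at hc
    simp_rw [herr] at hc
    rw [← ENNReal.ofReal_sum_of_nonneg fun m _ => by simp,
      ENNReal.ofReal_le_ofReal_iff (by positivity), Finset.sum_sub_distrib] at hc
    simp only [Finset.sum_const, Finset.card_univ, nsmul_eq_mul, mul_one] at hc
    linarith
  have htot := Finset.sum_le_sum fun m (_ : m ∈ Finset.univ) => key m
  rw [← Finset.mul_sum, Finset.sum_add_distrib, Finset.sum_sub_distrib, Finset.sum_add_distrib,
    ← Finset.mul_sum, hsumQ, Finset.sum_comm] at htot
  simp only [Finset.sum_const, Finset.card_univ, nsmul_eq_mul, mul_one, hcard'] at htot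
  have hs : ∑ t, ∑ m, ∫ y, Real.log (r t m y).toReal ∂(W.outLaw (c.input m t)) ≤ n * (N * D) := by
    refine (Finset.sum_le_sum fun t _ => hsum t).trans_eq ?_
    rw [Finset.sum_const, Finset.card_univ, Fintype.card_fin, nsmul_eq_mul, hcard']
  have h1 := mul_le_mul_of_nonneg_left hsumμ hlogN
  have h2 : N * ((1 - ε) * Real.log N) ≤ N * (n * D + 1) := by nlinarith
  exact le_of_mul_le_mul_left h2 (by linarith)

end MAC

/-! ### Combinatorics of tables with few bad entries. -/

theorem prod_le_pow_of_sum_le {K : ℕ} {a : Fin K → ℝ} (ha : ∀ k, 0 ≤ a k) {b : ℝ}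
    (h : ∑ k, a k ≤ K * b) : ∏ k, a k ≤ b ^ K := by
  rcases Nat.eq_zero_or_pos K with rfl | hK
  · simp
  have hK' : (0 : ℝ) < K := by exact_mod_cast hK
  have := Real.geom_mean_le_arith_mean_weighted Finset.univ (fun _ : Fin K => (K : ℝ)⁻¹) a
    (fun _ _ => by positivity) (by simp [hK.ne']) (fun k _ => ha k)
  rw [Real.finsetProd_rpow _ _ fun k _ => ha k, ← Finset.mul_sum] at this
  have hb : (∏ k, a k) ^ (K : ℝ)⁻¹ ≤ b := this.trans (by rwa [inv_mul_le_iff₀ hK'])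
  calc ∏ k, a k = ((∏ k, a k) ^ (K : ℝ)⁻¹) ^ K := by
        rw [Real.rpow_inv_natCast_pow (Finset.prod_nonneg fun k _ => ha k) hK.ne']
    _ ≤ b ^ K := pow_le_pow_left₀ (Real.rpow_nonneg (Finset.prod_nonneg fun k _ => ha k) _) hb _

/-- If in every row of a table with columns `G × Fin K` at most half of the entries are bad, then
suitable cyclic shifts of the slices `G × {k}` give a table in which every row meets every block
`{g} × Fin K` in an entry which is not bad. -/
theorem exists_shift_forall_exists_not {R G : Type*} [Fintype R] [Fintype G] [AddGroup G] {K : ℕ}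
    (bad : R → G × Fin K → Prop) [∀ r, DecidablePred (bad r)]
    (hbad : ∀ r, 2 * (Finset.univ.filter (bad r)).card ≤ Fintype.card G * K)
    (hcard : Fintype.card R * Fintype.card G < 2 ^ K) :
    ∃ s : Fin K → G, ∀ r g, ∃ k, ¬ bad r (g + s k, k) := by
  classical
  by_contra! hcon
  -- The shifts that fail for a given row and block. They form a product set, so AM-GM bounds their
  -- number by `(|G| / 2) ^ K`; the union bound over all rows and blocks then contradicts `hcard`.
  let S : R × G → Finset (Fin K → G) := fun q =>
    Fintype.piFinset fun k => Finset.univ.filter fun g => bad q.1 (q.2 + g, k)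
  have hcover : (Finset.univ : Finset (Fin K → G)) ⊆ Finset.univ.biUnion S := by
    intro s _
    obtain ⟨r, g, h⟩ := hcon s
    exact Finset.mem_biUnion.2 ⟨(r, g), Finset.mem_univ _, by simpa [S] using h⟩
  have hS : ∀ q, ((S q).card : ℝ) ≤ (Fintype.card G / 2 : ℝ) ^ K := by
    intro q
    have hc : ∀ k, (Finset.univ.filter fun g => bad q.1 (q.2 + g, k)).card =
        (Finset.univ.filter fun g => bad q.1 (g, k)).card := fun k =>
      Finset.card_bijective (q.2 + ·) (Equiv.addLeft q.2).bijective (by simp)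
    rw [Fintype.card_piFinset, Nat.cast_prod]
    refine prod_le_pow_of_sum_le (fun _ => by positivity) ?_
    have hsum : ∑ k, (Finset.univ.filter fun g => bad q.1 (g, k)).card =
        (Finset.univ.filter (bad q.1)).card := by
      simp_rw [Finset.card_filter]
      rw [Fintype.sum_prod_type_right]
    simp_rw [hc]
    rw [← Nat.cast_sum, hsum]
    have h2 : (2 * (Finset.univ.filter (bad q.1)).card : ℝ) ≤ Fintype.card G * K := by
      exact_mod_cast hbad q.1
    linarith
  have h1 : (Fintype.card G : ℝ) ^ K ≤
      (Fintype.card R * Fintype.card G) * (Fintype.card G / 2 : ℝ) ^ K := by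
    calc (Fintype.card G : ℝ) ^ K = ((Finset.univ : Finset (Fin K → G)).card : ℝ) := by simp
      _ ≤ ((∑ q, (S q).card : ℕ) : ℝ) := by
        exact_mod_cast (Finset.card_le_card hcover).trans Finset.card_biUnion_le
      _ ≤ ∑ _q : R × G, (Fintype.card G / 2 : ℝ) ^ K := by
        push_cast
        exact Finset.sum_le_sum fun q _ => hS q
      _ = _ := by simp
  have hG : (0 : ℝ) < (Fintype.card G : ℝ) ^ K := by
    have : 0 < Fintype.card G := Fintype.card_pos
    positivity
  rw [div_pow, ← mul_div_assoc, le_div_iff₀ (by positivity), mul_comm] at h1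
  have h2 := le_of_mul_le_mul_right h1 hG
  have h3 : (Fintype.card R * Fintype.card G : ℝ) < 2 ^ K := by exact_mod_cast hcard
  linarith

/-- In a table with few bad entries one can choose half of the rows, and blocks of at most `K`
columns that together make up a constant fraction of the columns, such that each of these rows
meets each of these blocks in an entry which is not bad. -/
theorem exists_rows_and_blocks {M₀ M₁ K : ℕ} (hM₀ : 0 < M₀) (hM₁ : 0 < M₁)
    (bad : Fin M₀ → Fin M₁ → Prop) [∀ r, DecidablePred (bad r)]
    (hbad : 8 * ∑ r, (Finset.univ.filter (bad r)).card ≤ M₀ * M₁)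
    (hK : 0 < K) (hcard : M₀ * M₁ < 2 ^ K) :
    ∃ a b k : ℕ, 0 < a ∧ 0 < b ∧ 0 < k ∧ a ≤ M₀ ∧ b ≤ M₁ ∧ k ≤ K ∧ M₀ ≤ 2 * a ∧ M₁ ≤ 2 * K * b ∧
      ∃ (row : Fin a → Fin M₀) (row' : Fin M₀ → Fin a) (col : Fin b → Fin k → Fin M₁)
        (col' : Fin M₁ → Fin b), (∀ i, row' (row i) = i) ∧ (∀ j l, col' (col j l) = j) ∧
        ∀ i j, ∃ l, ¬ bad (row i) (col j l) := by
  classical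
  -- Markov again: with at most an eighth of the table bad, at most half of the rows are more than a
  -- quarter bad.
  set good := Finset.univ.filter fun r => 4 * (Finset.univ.filter (bad r)).card ≤ M₁ with hgood
  have hgoodcard : M₀ ≤ 2 * good.card := by
    have h1 : goodᶜ.card * M₁ ≤ 4 * ∑ r, (Finset.univ.filter (bad r)).card := by
      rw [Finset.mul_sum, ← smul_eq_mul]
      refine (Finset.card_nsmul_le_sum goodᶜ (fun r => 4 * (Finset.univ.filter (bad r)).card) M₁
        fun r hr => ?_).trans (Finset.sum_le_sum_of_subset (Finset.subset_univ _))
      simp only [hgood, Finset.mem_compl, Finset.mem_filter, Finset.mem_univ, true_and] at hr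
      omega
    have h2 : 2 * goodᶜ.card ≤ M₀ := by
      refine le_of_mul_le_mul_right ?_ hM₁
      linarith
    have h3 := Finset.card_add_card_compl good
    rw [Fintype.card_fin] at h3
    omega
  have ha : 0 < good.card := by omega
  have haM : good.card ≤ M₀ := by simpa using Finset.card_le_univ good
  let e : Fin good.card ≃ good := good.equivFin.symm
  have : Nonempty (Fin good.card) := ⟨⟨0, ha⟩⟩
  let row : Fin good.card → Fin M₀ := fun i => e i
  have hrow : Function.Injective row := Subtype.val_injective.comp e.injective
  have hrowgood : ∀ i, 4 * (Finset.univ.filter (bad (row i))).card ≤ M₁ := fun i =>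
    (Finset.mem_filter.1 (e i).2).2
  -- With fewer than `K` columns, all of them form a single block, and a good row is not entirely
  -- bad.
  rcases lt_or_ge M₁ K with hlt | hge
  · refine ⟨good.card, 1, M₁, ha, one_pos, hM₁, haM, hM₁, hlt.le, hgoodcard, by omega, row,
      Function.invFun row, fun _ l => l, fun _ => 0, Function.leftInverse_invFun hrow,
      fun j _ => Subsingleton.elim _ _, fun i _ => ?_⟩
    by_contra! hcon
    have h := hrowgood i
    rw [Finset.filter_true_of_mem fun l _ => hcon l, Finset.card_univ, Fintype.card_fin] at h
    omega
  · set b := M₁ / K with hb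
    have hb0 : 0 < b := Nat.div_pos hge hK
    have hbK : b * K ≤ M₁ := Nat.div_mul_le_self M₁ K
    -- Truncating to `b * K` columns keeps at least half of them, so a quarter of `M₁` is at most
    -- half of what remains, as the shift lemma needs.
    have hM₁b : M₁ ≤ 2 * (b * K) := by
      have h1 : M₁ < (b + 1) * K := by
        rw [mul_comm]
        exact Nat.lt_mul_div_succ M₁ hK
      nlinarith
    have hne : NeZero b := ⟨hb0.ne'⟩
    have hbM : b ≤ M₁ := Nat.div_le_self _ _
    let f : ZMod b ≃ Fin b := (Fintype.equivFinOfCardEq (ZMod.card b))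
    let emb : ZMod b × Fin K ↪ Fin M₁ :=
      ((f.prodCongr (Equiv.refl _)).trans finProdFinEquiv).toEmbedding.trans (Fin.castLEEmb hbK)
    obtain ⟨s, hs⟩ := exists_shift_forall_exists_not (R := Fin good.card)
      (fun i z => bad (row i) (emb z)) (fun i => by
        have h1 : (Finset.univ.filter fun z => bad (row i) (emb z)).card ≤
            (Finset.univ.filter (bad (row i))).card :=
          Finset.card_le_card_of_injOn emb (fun z hz => by simpa using hz) emb.injective.injOn
        have h2 := hrowgood i
        rw [ZMod.card]
        omega)
      (by
        rw [ZMod.card, Fintype.card_fin]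
        exact (Nat.mul_le_mul haM hbM).trans_lt hcard)
    let F : Fin b × Fin K → Fin M₁ := fun z => emb (f.symm z.1 + s z.2, z.2)
    have hF : Function.Injective F := by
      rintro ⟨j, l⟩ ⟨j', l'⟩ h
      obtain ⟨h1, rfl⟩ := Prod.mk.inj (emb.injective h)
      rw [add_left_inj, f.symm.injective.eq_iff] at h1
      exact Prod.ext h1 rfl
    have : Nonempty (Fin b × Fin K) := ⟨(⟨0, hb0⟩, ⟨0, hK⟩)⟩
    refine ⟨good.card, b, K, ha, hb0, hK, haM, hbM, le_rfl, hgoodcard, by linarith, row,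
      Function.invFun row, fun j l => F (j, l), fun m => (Function.invFun F m).1,
      Function.leftInverse_invFun hrow, fun j l => congrArg Prod.fst (Function.leftInverse_invFun hF (j, l)),
      fun i j => hs i (f.symm j)⟩

/-! ### The one-round code with a label chosen by the facilitator. -/

namespace Code

variable {X₁ X₂ Y : Type*} [MeasurableSpace Y] {Cin Cout : Fin 2 → ℝ} {n J : ℕ}

/-- The one-round code in which the encoders send their whole messages to the facilitator, which
selects a label in `Fin k` for the message pair, simulates all rounds of `c` on the labelled
messages, and forwards the outcome together with the label. The transmission is padded with the
inputs `x₁` and `x₂`. -/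
noncomputable def relabel (c : Code X₁ X₂ Y Cin Cout n J) {N : ℕ} (hnN : n ≤ N) (x₁ : X₁) (x₂ : X₂)
    {k : ℕ} (hk : 0 < k) (M' : Fin 2 → ℕ) (hM' : ∀ i, 0 < M' i)
    (enc : ∀ i, Fin (M' i) → Fin k → Fin (c.M i)) (sel : (∀ i, Fin (M' i)) → Fin k)
    (dec : ∀ i, Fin (c.M i) → Fin (M' i)) (hU : ∀ i, Real.logb 2 (M' i) ≤ N * Cin i)
    (hV : ∀ i, n * Cout i + Real.logb 2 k ≤ N * Cout i) : Code X₁ X₂ Y Cin Cout N 1 where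
  M := M'
  M_pos := hM'
  U i _ := M' i
  U_pos i _ := hM' i
  V i _ := Fintype.card ((∀ j, Fin (c.V i j)) × Fin k)
  V_pos i _ := by
    exact Fintype.card_pos_iff.2 ⟨fun j => ⟨0, c.V_pos i j⟩, ⟨0, hk⟩⟩
  U_rate i := by simpa using hU i
  V_rate i := by
    have hpos : ∀ j, (c.V i j : ℝ) ≠ 0 := fun j => by exact_mod_cast (c.V_pos i j).ne'
    have hk' : (k : ℝ) ≠ 0 := by exact_mod_cast hk.ne'
    simp only [Fintype.card_prod, Fintype.card_pi, Fintype.card_fin, Finset.univ_unique,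
      Finset.sum_singleton]
    push_cast
    rw [Real.logb_mul (Finset.prod_ne_zero_iff.2 fun j _ => hpos j) hk', Real.logb_prod _ _
      fun j _ => hpos j]
    linarith [c.V_rate i, hV i]
  φ _ _ m _ := m
  ψ i j u := Fintype.equivFin _
    (fun j' => c.v (fun i' => enc i' (u i' ⟨j, le_rfl⟩) (sel fun i' => u i' ⟨j, le_rfl⟩)) j' i,
      sel fun i' => u i' ⟨j, le_rfl⟩)
  f₁ m w t := if h : t < n then
      c.f₁ (enc 0 m ((Fintype.equivFin _).symm (w 0)).2) ((Fintype.equivFin _).symm (w 0)).1 ⟨t, h⟩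
    else x₁
  f₂ m w t := if h : t < n then
      c.f₂ (enc 1 m ((Fintype.equivFin _).symm (w 0)).2) ((Fintype.equivFin _).symm (w 0)).1 ⟨t, h⟩
    else x₂
  g y i := dec i (c.g (fun t => y (Fin.castLE hnN t)) i)
  measurable_g := by
    refine measurable_pi_lambda _ fun i => ?_
    refine (measurable_from_top (f := dec i)).comp ((measurable_pi_apply i).comp
      (c.measurable_g.comp (by fun_prop)))

section

variable (c : Code X₁ X₂ Y Cin Cout n J) {N : ℕ} (hnN : n ≤ N) (x₁ : X₁) (x₂ : X₂)
    {k : ℕ} (hk : 0 < k) (M' : Fin 2 → ℕ) (hM' : ∀ i, 0 < M' i)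
    (enc : ∀ i, Fin (M' i) → Fin k → Fin (c.M i)) (sel : (∀ i, Fin (M' i)) → Fin k)
    (dec : ∀ i, Fin (c.M i) → Fin (M' i)) (hU : ∀ i, Real.logb 2 (M' i) ≤ N * Cin i)
    (hV : ∀ i, n * Cout i + Real.logb 2 k ≤ N * Cout i)

theorem relabel_v (m : ∀ i, Fin (M' i)) (j : Fin 1) (i : Fin 2) :
    (c.relabel hnN x₁ x₂ hk M' hM' enc sel dec hU hV).v m j i =
      Fintype.equivFin _ (fun j' => c.v (fun i' => enc i' (m i') (sel m)) j' i, sel m) := by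
  exact (Code.v.eq_def _ _ _ _).trans rfl

theorem relabel_input (m : ∀ i, Fin (M' i)) (t : Fin n) :
    (c.relabel hnN x₁ x₂ hk M' hM' enc sel dec hU hV).input m (Fin.castLE hnN t) =
      c.input (fun i => enc i (m i) (sel m)) t := by
  simp only [Code.input, relabel_v]
  simp [relabel]

/-- The first `n` outputs are distributed as in the old code for the selected messages. The new
decoder is right whenever the old one is, and possibly more often, since it discards the label. -/
theorem errorProb_relabel_le [MeasurableSpace X₁] [MeasurableSpace X₂] {ν : Measure Y}
    [SigmaFinite ν] (W : MAC X₁ X₂ Y ν) (hdec : ∀ i m l, dec i (enc i m l) = m)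
    (m : ∀ i, Fin (M' i)) :
    W.errorProb (c.relabel hnN x₁ x₂ hk M' hM' enc sel dec hU hV) m ≤
      W.errorProb c fun i => enc i (m i) (sel m) := by
  set c' := c.relabel hnN x₁ x₂ hk M' hM' enc sel dec hU hV with hc'
  set m₀ : ∀ i, Fin (c.M i) := fun i => enc i (m i) (sel m) with hm₀
  have hs : MeasurableSet {y | c.g y ≠ m₀} := (c.measurable_g (measurableSet_singleton m₀)).compl
  have hmap := Measure.pi_map_comp_embedding (fun t => W.outLaw (c'.input m t))
    (Fin.castLEEmb hnN)
  have hin : ∀ t, c'.input m (Fin.castLEEmb hnN t) = c.input m₀ t := fun t =>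
    relabel_input c hnN x₁ x₂ hk M' hM' enc sel dec hU hV m t
  simp_rw [hin] at hmap
  calc W.errorProb c' m = Measure.pi (fun t => W.outLaw (c'.input m t)) {y | c'.g y ≠ m} :=
        W.errorProb_eq c' m
    _ ≤ Measure.pi (fun t => W.outLaw (c'.input m t))
        ((fun y t => y (Fin.castLEEmb hnN t)) ⁻¹' {y | c.g y ≠ m₀}) := measure_mono ?_
    _ = W.errorProb c m₀ := by
        rw [MAC.errorProb_eq, ← hmap, Measure.map_apply (by fun_prop) hs]
  refine fun y hy hy' => hy ?_
  funext i
  change dec i (c.g (fun t => y (Fin.castLE hnN t)) i) = m i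
  have h : c.g (fun t => y (Fin.castLE hnN t)) = m₀ := hy'
  rw [h, hdec]

end

end Code

namespace MAC

variable {X₁ X₂ Y : Type*} [MeasurableSpace X₁] [MeasurableSpace X₂] [MeasurableSpace Y]
  {ν : Measure Y} {Cin Cout : Fin 2 → ℝ} {n J : ℕ}

theorem exists_code_maxError_le [SigmaFinite ν] (W : MAC X₁ X₂ Y ν) (c : Code X₁ X₂ Y Cin Cout n J) (hn : 0 < n)
    {N : ℕ} (hnN : n ≤ N) {ε : ℝ} (hε : 0 < ε) (hc : W.avgError c ≤ ENNReal.ofReal (ε / 8))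
    {K : ℕ} (hK : 0 < K) (hcard : c.M 0 * c.M 1 < 2 ^ K)
    (hU : ∀ i, Real.logb 2 (c.M i) ≤ N * Cin i)
    (hCout : ∀ i, n * Cout i + Real.logb 2 K ≤ N * Cout i) :
    ∃ c' : Code X₁ X₂ Y Cin Cout N 1, c.M 0 ≤ 2 * c'.M 0 ∧ c.M 1 ≤ 2 * K * c'.M 1 ∧
      W.maxError c' ≤ ENNReal.ofReal ε := by
  classical
  let pair : Fin (c.M 0) → Fin (c.M 1) → ∀ i, Fin (c.M i) := fun r s i =>
    match i with
    | 0 => r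
    | 1 => s
  let bad : Fin (c.M 0) → Fin (c.M 1) → Prop := fun r s =>
    ENNReal.ofReal ε < W.errorProb c (pair r s)
  have hbad : 8 * ∑ r, (Finset.univ.filter (bad r)).card ≤ c.M 0 * c.M 1 := by
    have hM : ((c.M 0 : ℝ≥0∞) * c.M 1) ≠ 0 := by
      have := c.M_pos 0
      have := c.M_pos 1
      simp; omega
    have hM' : ((c.M 0 : ℝ≥0∞) * c.M 1) ≠ ∞ := ENNReal.mul_ne_top (by simp) (by simp)
    rw [avgError, ENNReal.div_le_iff hM hM'] at hc
    have hsum : ∑ m : ∀ i, Fin (c.M i), W.errorProb c m = ∑ r, ∑ s, W.errorProb c (pair r s) := by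
      rw [← Fintype.sum_prod_type']
      refine Fintype.sum_equiv (piFinTwoEquiv fun i => Fin (c.M i)) _ _ fun m => ?_
      congr 1
      funext i
      fin_cases i <;> rfl
    have hle : ENNReal.ofReal ε * (∑ r, (Finset.univ.filter (bad r)).card : ℕ) ≤
        ∑ r, ∑ s, W.errorProb c (pair r s) := by
      rw [Nat.cast_sum, Finset.mul_sum]
      refine Finset.sum_le_sum fun r _ => ?_
      rw [mul_comm, ← nsmul_eq_mul]
      exact (Finset.card_nsmul_le_sum _ (fun s => W.errorProb c (pair r s)) _
        fun s hs => (Finset.mem_filter.1 hs).2.le).trans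
        (Finset.sum_le_sum_of_subset (Finset.subset_univ _))
    rw [hsum] at hc
    have h1 := hle.trans hc
    have h8 : ENNReal.ofReal ε = ENNReal.ofReal (ε / 8) * 8 := by
      rw [← ENNReal.ofReal_ofNat 8, ← ENNReal.ofReal_mul (by positivity)]
      congr 1
      ring
    replace h1 : ENNReal.ofReal (ε / 8) *
        (8 * (∑ r, (Finset.univ.filter (bad r)).card : ℕ)) ≤
          ENNReal.ofReal (ε / 8) * (c.M 0 * c.M 1) := by
      rw [← mul_assoc, ← h8]
      exact h1
    have h2 := (ENNReal.mul_le_mul_iff_right (by simpa using hε) ENNReal.ofReal_ne_top).1 h1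
    exact_mod_cast h2
  obtain ⟨a, b, k, ha, hb, hk, haM, hbM, hkK, hM₀, hM₁, row, row', col, col', hrow, hcol, hgood⟩ :=
    exists_rows_and_blocks (c.M_pos 0) (c.M_pos 1) bad hbad hK hcard
  choose sel hsel using hgood
  -- The padding letters are arbitrary; as `0 < n`, the old code itself supplies them.
  have x₁ : X₁ := c.f₁ ⟨0, c.M_pos 0⟩ (fun j => ⟨0, c.V_pos 0 j⟩) ⟨0, hn⟩
  have x₂ : X₂ := c.f₂ ⟨0, c.M_pos 1⟩ (fun j => ⟨0, c.V_pos 1 j⟩) ⟨0, hn⟩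
  let M' : Fin 2 → ℕ := ![a, b]
  have hM' : ∀ i, 0 < M' i := by
    intro i; fin_cases i; exacts [ha, hb]
  have hM'M : ∀ i, M' i ≤ c.M i := by
    intro i; fin_cases i; exacts [haM, hbM]
  -- Only the second user's message varies with the label.
  let enc : ∀ i, Fin (M' i) → Fin k → Fin (c.M i) := fun i =>
    match i with
    | 0 => fun m _ => row m
    | 1 => fun m l => col m l
  let dec : ∀ i, Fin (c.M i) → Fin (M' i) := fun i =>
    match i with
    | 0 => row'
    | 1 => col'
  have hdec : ∀ i m l, dec i (enc i m l) = m := by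
    intro i
    fin_cases i
    exacts [fun m _ => hrow m, fun m l => hcol m l]
  have hU' : ∀ i, Real.logb 2 (M' i) ≤ N * Cin i := fun i =>
    (Real.logb_le_logb_of_le one_lt_two (by exact_mod_cast hM' i)
      (by exact_mod_cast hM'M i)).trans (hU i)
  have hV' : ∀ i, n * Cout i + Real.logb 2 k ≤ N * Cout i := fun i =>
    (add_le_add_right (Real.logb_le_logb_of_le one_lt_two (by exact_mod_cast hk)
      (by exact_mod_cast hkK)) _).trans (hCout i)
  refine ⟨c.relabel hnN x₁ x₂ hk M' hM' enc (fun m => sel (m 0) (m 1)) dec hU' hV', hM₀, hM₁,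
    iSup_le fun m => ?_⟩
  refine (c.errorProb_relabel_le hnN x₁ x₂ hk M' hM' enc _ dec hU' hV' W hdec m).trans ?_
  have h := not_lt.1 (hsel (m 0) (m 1))
  convert h using 2
  funext i
  fin_cases i <;> rfl

end MAC

/-! ### Asymptotics and the comparison of the regions. -/

theorem eventually_logb_le_mul {A θ : ℝ} (hA : 0 < A) (hθ : 0 < θ) :
    ∀ᶠ N : ℕ in atTop, Real.logb 2 (A * N + 2) ≤ θ * N := by
  have hlog : 0 < Real.log 2 := Real.log_pos one_lt_two
  have hN : Tendsto (fun N : ℕ => A * (N : ℝ)) atTop atTop :=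
    tendsto_natCast_atTop_atTop.const_mul_atTop hA
  have ht : Tendsto (fun N : ℕ => A * (N : ℝ) + 2) atTop atTop :=
    tendsto_atTop_add_const_right _ _ hN
  have hc : 0 < θ * Real.log 2 / (2 * A) := by positivity
  filter_upwards [ht.eventually (Real.isLittleO_log_id_atTop.bound hc),
    hN.eventually_ge_atTop 2] with N h1 h2
  rw [Real.logb, div_le_iff₀ hlog]
  have h3 := (le_abs_self _).trans h1
  rw [id, Real.norm_eq_abs, abs_of_nonneg (by linarith : (0 : ℝ) ≤ A * N + 2)] at h3
  calc Real.log (A * N + 2) ≤ θ * Real.log 2 / (2 * A) * (A * N + 2) := h3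
    _ ≤ θ * Real.log 2 / (2 * A) * (2 * (A * N)) :=
      mul_le_mul_of_nonneg_left (by linarith) hc.le
    _ = θ * N * Real.log 2 := by field_simp

namespace MAC

variable {X₁ X₂ Y : Type*} [MeasurableSpace X₁] [MeasurableSpace X₂] [MeasurableSpace Y]
  {ν : Measure Y} {Cin Cout : Fin 2 → ℝ} {n J : ℕ}

theorem avgError_le_maxError (W : MAC X₁ X₂ Y ν) (c : Code X₁ X₂ Y Cin Cout n J) :
    W.avgError c ≤ W.maxError c := by
  have hM : ((c.M 0 : ℝ≥0∞) * c.M 1) ≠ 0 := by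
    have := c.M_pos 0
    have := c.M_pos 1
    simp; omega
  rw [avgError, ENNReal.div_le_iff hM (ENNReal.mul_ne_top (by simp) (by simp))]
  refine (Finset.sum_le_card_nsmul _ _ (W.maxError c) fun m _ => le_iSup (W.errorProb c) m).trans ?_
  rw [nsmul_eq_mul, mul_comm]
  simp [Fin.prod_univ_two]

/-- If the cooperation facilitator has enough input capacity to learn both messages, vanishing
average error implies vanishing maximal error, with a single round of cooperation. -/
theorem Achievable.maxError_of_avgError [SigmaFinite ν] (W : MAC X₁ X₂ Y ν)
    (hCin : W.maxMutualInfo < ENNReal.ofReal (min (Cin 0) (Cin 1))) (hCout : ∀ i, 0 < Cout i)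
    {R : Fin 2 → ℝ} (hR : Achievable Cin Cout J (fun _ c => W.avgError c) R) :
    Achievable Cin Cout 1 (fun _ c => W.maxError c) R := by
  refine ⟨hR.1, fun ε hε δ hδ => ?_⟩
  set A := min (Cin 0) (Cin 1) with hA
  set C := W.maxMutualInfo.toReal with hC
  have hCtop : W.maxMutualInfo ≠ ∞ := hCin.ne_top
  have hA0 : 0 < A := ENNReal.ofReal_pos.1 (bot_le.trans_lt hCin)
  have hC0 : 0 ≤ C := ENNReal.toReal_nonneg
  have hCA : C < A := (ENNReal.lt_ofReal_iff_toReal_lt hCtop).1 hCin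
  have hACin : ∀ i, A ≤ Cin i := by
    intro i; fin_cases i; exacts [min_le_left _ _, min_le_right _ _]
  have hlog : 0 < Real.log 2 := Real.log_pos one_lt_two
  -- Chosen so that `(1 - e₀) * A` is the midpoint of `C` and `A`: the weak converse at error `e₀`
  -- then gives sum rate at most `A`, once `n` is large enough to absorb its additive constant.
  set e₀ := (A - C) / (2 * A) with he₀
  have he₀pos : 0 < e₀ := div_pos (by linarith) (by linarith)
  have he₀A : (1 - e₀) * A = (A + C) / 2 := by rw [he₀]; field_simp; ring
  set e := min ε e₀ with he
  have hepos : 0 < e := lt_min hε he₀pos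
  have hR0 := hR.1 0
  have hR1 := hR.1 1
  set η := min (1 / 2) (δ / (4 * (R 0 + R 1 + 1))) with hη
  have hS : 0 < R 0 + R 1 + 1 := by linarith
  have hηpos : 0 < η := lt_min (by norm_num) (by positivity)
  have hη2 : η ≤ 1 / 2 := min_le_left _ _
  have hηR : ∀ i, η * R i ≤ δ / 4 := by
    intro i
    have h1 : R i ≤ R 0 + R 1 + 1 := by fin_cases i <;> simp <;> linarith
    calc η * R i ≤ δ / (4 * (R 0 + R 1 + 1)) * (R 0 + R 1 + 1) :=
          mul_le_mul (min_le_right _ _) h1 (hR.1 i) (by positivity)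
      _ = δ / 4 := by field_simp
  -- The old code runs for `len N` of the `N` channel uses; the remaining fraction `η` buys
  -- output-link capacity for the label.
  let len : ℕ → ℕ := fun N => N - ⌈η * N⌉₊
  have hceil : ∀ N : ℕ, ⌈η * N⌉₊ ≤ N := fun N => by
    rw [Nat.ceil_le]
    have : (0 : ℝ) ≤ N := by positivity
    nlinarith
  have hlen : ∀ N : ℕ, (len N : ℝ) ≤ N - η * N ∧ N - η * N - 1 ≤ (len N : ℝ) := by
    intro N
    have h1 : (len N : ℝ) = N - ⌈η * N⌉₊ := Nat.cast_sub (hceil N)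
    have h2 := Nat.le_ceil (η * N)
    have h3 := Nat.ceil_lt_add_one (by positivity : 0 ≤ η * N)
    constructor <;> linarith
  have hlentop : Tendsto len atTop atTop := by
    rw [← tendsto_natCast_atTop_iff (R := ℝ)]
    have h1 : Tendsto (fun N : ℕ => (1 / 2 : ℝ) * N - 1) atTop atTop :=
      tendsto_atTop_add_const_right _ _
        (tendsto_natCast_atTop_atTop.const_mul_atTop (by norm_num))
    refine tendsto_atTop_mono (fun N => ?_) h1
    have h2 : (0 : ℝ) ≤ N := by positivity
    have := (hlen N).2
    nlinarith
  have hlarge : ∀ᶠ N : ℕ in atTop, 1 ≤ len N ∧ 1 ≤ (len N : ℝ) * ((A - C) / 2 * Real.log 2) := by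
    have hpos : 0 < (A - C) / 2 * Real.log 2 := mul_pos (by linarith) hlog
    exact (hlentop.eventually_ge_atTop 1).and
      (((tendsto_natCast_atTop_atTop.comp hlentop).atTop_mul_const hpos).eventually_ge_atTop 1)
  have hrate : ∀ᶠ N : ℕ in atTop, R 0 + R 1 + 1 ≤ δ / 4 * N :=
    (tendsto_natCast_atTop_atTop.const_mul_atTop (by positivity : 0 < δ / 4)).eventually_ge_atTop _
  filter_upwards [hlentop.eventually (hR.2 (e / 8) (by positivity) (δ / 4) (by positivity)), hlarge,
    hrate, eventually_logb_le_mul hA0 (by positivity : 0 < δ / 4),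
    eventually_logb_le_mul hA0 (mul_pos hηpos (hCout 0)),
    eventually_logb_le_mul hA0 (mul_pos hηpos (hCout 1))]
    with N hcode hnlarge hN hKδ hK0 hK1
  have hnN : len N ≤ N := Nat.sub_le _ _
  have hlenN := hlen N
  generalize len N = n at hcode hnlarge hnN hlenN
  obtain ⟨c, hcR, hce⟩ := hcode
  obtain ⟨hn1, hn2⟩ := hnlarge
  have hnpos : (0 : ℝ) < n := by exact_mod_cast hn1
  have hnN' : (n : ℝ) ≤ N := by exact_mod_cast hnN
  have hNpos : (0 : ℝ) < N := hnpos.trans_le hnN'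
  have hM0 : (1 : ℝ) ≤ c.M 0 := by exact_mod_cast c.M_pos 0
  have hM1 : (1 : ℝ) ≤ c.M 1 := by exact_mod_cast c.M_pos 1
  have hMM : (0 : ℝ) < c.M 0 * c.M 1 := by positivity
  have hsum : Real.logb 2 (c.M 0 * c.M 1) ≤ n * A := by
    have h := W.log_card_le hCtop c he₀pos.le (hce.trans (ENNReal.ofReal_le_ofReal
      (by have := min_le_right ε e₀; linarith)))
    rw [Real.logb, div_le_iff₀ hlog]
    have h1 : 0 < 1 - e₀ := by
      by_contra! hcon
      nlinarith
    refine le_of_mul_le_mul_left ?_ h1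
    calc (1 - e₀) * Real.log (c.M 0 * c.M 1) ≤ n * (C * Real.log 2) + 1 := h
      _ ≤ n * (C * Real.log 2) + n * ((A - C) / 2 * Real.log 2) := by linarith
      _ = (1 - e₀) * A * n * Real.log 2 := by rw [he₀A]; ring
      _ = (1 - e₀) * (n * A * Real.log 2) := by ring
  -- Large enough that `2 ^ K` exceeds the number of message pairs, yet linear in `N`, so `logb 2 K`
  -- is sublinear.
  set K := ⌈A * N⌉₊ + 1 with hK
  have hKpos : 0 < K := Nat.succ_pos _
  have hKle : (K : ℝ) ≤ A * N + 2 := by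
    have := Nat.ceil_lt_add_one (by positivity : 0 ≤ A * N)
    rw [hK]; push_cast; linarith
  have hlogK : Real.logb 2 K ≤ Real.logb 2 (A * N + 2) :=
    Real.logb_le_logb_of_le one_lt_two (by exact_mod_cast hKpos) hKle
  have hcard : c.M 0 * c.M 1 < 2 ^ K := by
    have h1 : (c.M 0 * c.M 1 : ℝ) < 2 ^ (K : ℝ) := by
      rw [← Real.logb_lt_iff_lt_rpow one_lt_two hMM]
      have h2 := Nat.le_ceil (A * N)
      have h3 : (n : ℝ) * A ≤ A * N := by nlinarith
      rw [hK]; push_cast; linarith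
    rw [Real.rpow_natCast] at h1
    exact_mod_cast h1
  have hMle : ∀ i, (c.M i : ℝ) ≤ c.M 0 * c.M 1 := by
    intro i
    fin_cases i
    · exact le_mul_of_one_le_right (by positivity) hM1
    · exact le_mul_of_one_le_left (by positivity) hM0
  obtain ⟨c', hc0, hc1, hmax⟩ := W.exists_code_maxError_le c hn1 hnN hepos hce hKpos hcard
    (fun i => by
      have h1 := Real.logb_le_logb_of_le one_lt_two (by exact_mod_cast c.M_pos i) (hMle i)
      have h2 : (n : ℝ) * A ≤ N * Cin i := mul_le_mul hnN' (hACin i) hA0.le hNpos.le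
      linarith)
    (fun i => by
      have h1 : Real.logb 2 (A * N + 2) ≤ η * Cout i * N := by
        fin_cases i
        exacts [hK0, hK1]
      have h2 := mul_le_mul_of_nonneg_right hlenN.1 (hCout i).le
      linarith)
  refine ⟨c', fun i => ?_, hmax.trans (ENNReal.ofReal_le_ofReal (min_le_left _ _))⟩
  have hMi : c.M i ≤ 2 * K * c'.M i := by
    fin_cases i
    · refine hc0.trans ?_
      have : c'.M 0 ≤ K * c'.M 0 := Nat.le_mul_of_pos_left _ hKpos
      change 2 * c'.M 0 ≤ 2 * K * c'.M 0
      linarith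
    · exact hc1
  have hM'pos : (0 : ℝ) < c'.M i := by exact_mod_cast c'.M_pos i
  have hKpos' : (0 : ℝ) < K := by exact_mod_cast hKpos
  have h1 : Real.logb 2 (c.M i) ≤ 1 + Real.logb 2 K + Real.logb 2 (c'.M i) := by
    have h : Real.logb 2 (c.M i) ≤ Real.logb 2 (2 * K * c'.M i) :=
      Real.logb_le_logb_of_le one_lt_two (by exact_mod_cast c.M_pos i) (by exact_mod_cast hMi)
    rwa [Real.logb_mul (by positivity) hM'pos.ne', Real.logb_mul (by norm_num) hKpos'.ne',
      Real.logb_self_eq_one one_lt_two] at h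
  have h2 := hcR i
  rw [one_div, ← div_eq_inv_mul, le_div_iff₀ hnpos] at h2
  rw [one_div, ← div_eq_inv_mul, le_div_iff₀ hNpos]
  have h3 : (N - η * N - 1) * R i ≤ n * R i := mul_le_mul_of_nonneg_right hlenN.2 (hR.1 i)
  have h4 : η * R i * N ≤ δ / 4 * N := mul_le_mul_of_nonneg_right (hηR i) hNpos.le
  have h5 : δ / 4 * n ≤ δ / 4 * N := mul_le_mul_of_nonneg_left hnN' (by positivity)
  have h6 : R i ≤ R 0 + R 1 := by fin_cases i <;> simp <;> linarith
  -- The loss `δ * N` splits into quarters: the rate slack of the old code, the padding, the label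
  -- size `logb 2 K`, and the constants `R i + 1` from rounding and the factor `2`.
  linarith

end MAC

theorem theorem2 {X₁ X₂ Y : Type*} [MeasurableSpace X₁] [MeasurableSpace X₂] [MeasurableSpace Y]
    (ν : Measure Y) [SigmaFinite ν] (W : MAC X₁ X₂ Y ν)
    (Cin : Fin 2 → ℝ) (hCin : W.maxMutualInfo < ENNReal.ofReal (min (Cin 0) (Cin 1)))
    (Cout : Fin 2 → ℝ) (hCout : ∀ i, 0 < Cout i) :
    W.maxRegion Cin Cout = W.avgRegion Cin Cout := by
  refine Set.Subset.antisymm (closure_mono ?_) (closure_mono ?_)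
  · refine Set.iUnion₂_mono fun J _ => closure_mono fun R hR => ⟨hR.1, fun ε hε δ hδ => ?_⟩
    filter_upwards [hR.2 ε hε δ hδ] with n ⟨c, hc, herr⟩
    exact ⟨c, hc, (W.avgError_le_maxError c).trans herr⟩
  -- Whatever `J` is, the maximal-error code needs only one round.
  · refine Set.iUnion₂_subset fun J _ => Set.subset_iUnion₂_of_subset 1 le_rfl ?_
    exact closure_mono fun R hR => MAC.Achievable.maxError_of_avgError W hCin hCout hR
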